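/- **Binomial extension of the Bressoud–Göllnitz–Gordon identities.** Let $q$ be a complex number with $0<|q|<1$ and write $(a;q)_n=\prod_{i=0}^{n-1}(1-aq^i)$ for integers $n\ge 0$, $(a;q)_\infty=\prod_{i\ge0}(1-aq^i)$ and $(a,b,c;q)_\infty=(a;q)_\infty(b;q)_\infty(c;q)_\infty$. Let $j,r\ge 0$ and $k\ge 1$ be integers with $j+r\le k$. Then \[ \sum_{s_1\ge\cdots\ge s_k\ge0}\frac{q^{2(s_1^2+\cdots+s_k^2+s_{k-r+1}+\cdots+s_k)}\;q^{-2s_1}(q^{2s_1}+q^{-2s_2})\cdots(q^{2s_{j-1}}+q^{-2s_j})\;(-q^{1+2s_k};q^2)_\infty}{(q^2;q^2)_{s_1-s_2}\cdots(q^2;q^2)_{s_{k-1}-s_k}\,(q^2;q^2)_{s_k}} \] \[ =\frac{(-q^3;q^2)_\infty}{(q^2;q^2)_\infty}\sum_{s=0}^{j}\binom{j}{s}\Big((q^{4k+4},q^{2k+3-2r+2j-4s},q^{2k+1+2r-2j+4s};q^{4k+4})_\infty+q\,(q^{4k+4},q^{2k+1-2r+2j-4s},q^{2k+3+2r-2j+4s};q^{4k+4})_\infty\Big),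 \] where the multisum converges absolutely and the weight $q^{-2s_1}(q^{2s_1}+q^{-2s_2})\cdots(q^{2s_{j-1}}+q^{-2s_j})$ is the product of its $j$ displayed factors $q^{-2s_1}$ and $q^{2s_{i-1}}+q^{-2s_i}$ ($2\le i\le j$), so that it is $1$ for $j=0$. Moreover, the same identity holds when this weight is replaced by the product of the elements of any $j$-element subset of $\{q^{-2s_1}\}\cup\{q^{2s_{i-1}}+q^{-2s_i}: 2\le i\le k-r\}$. -/

import Mathlib

/-- The finite q-Pochhammer symbol `(a; q)_n = ∏_{0 ≤ i < n} (1 - a q^i)`. -/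
noncomputable def qPoch (a q : ℂ) (n : ℕ) : ℂ :=
  ∏ i ∈ Finset.range n, (1 - a * q ^ i)

/-- The infinite q-Pochhammer symbol `(a; q)_∞ = ∏_{i ≥ 0} (1 - a q^i)`. -/
noncomputable def qPochInf (a q : ℂ) : ℂ :=
  ∏' i : ℕ, (1 - a * q ^ i)

/-- The infinite product `(a; q)_∞` converges for `|q| < 1`. -/
theorem multipliable_qPochInf (a q : ℂ) (hq : ‖q‖ < 1) :
    Multipliable (fun i : ℕ => 1 - a * q ^ i) := by
  have h : Summable (fun i : ℕ => ‖-(a * q ^ i)‖) := by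
    simp only [norm_neg, norm_mul, norm_pow]
    exact (summable_geometric_of_lt_one (norm_nonneg q) hq).mul_left _
  simpa only [sub_eq_add_neg] using multipliable_one_add_of_summable h

/-- The product `(a, b, c; q)_∞ = (a; q)_∞ (b; q)_∞ (c; q)_∞`. -/
noncomputable def qPochInf3 (a b c q : ℂ) : ℂ :=
  qPochInf a q * qPochInf b q * qPochInf c q

/-- The index set of the multisum: the `k`-tuples of integers `s_1 ≥ ⋯ ≥ s_k ≥ 0`. -/
abbrev DecTuple (k : ℕ) : Type := {s : Fin k → ℕ // Antitone s}

/-- The entry `s_i` of a tuple, with the indices running from `1` to `k`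
(the value `0` outside this range is never used). -/
def DecTuple.entry {k : ℕ} (s : DecTuple k) (i : ℕ) : ℕ :=
  if h : 1 ≤ i ∧ i ≤ k then s.1 ⟨i - 1, by omega⟩ else 0

/-- The available weight factors: the factor with index `1` is `q^(-2 s_1)`, the factor with
index `i ≥ 2` is `q^(2 s_{i-1}) + q^(-2 s_i)`. -/
noncomputable def bggFactor (q : ℂ) {k : ℕ} (s : DecTuple k) (i : ℕ) : ℂ :=
  if i = 1 then q ^ (-2 * (s.entry 1 : ℤ))
  else q ^ (2 * (s.entry (i - 1) : ℤ)) + q ^ (-2 * (s.entry i : ℤ))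

/-- The summand of the multisum, with the product of the weight factors with index in `T`:
`q^(2 (s_1² + ⋯ + s_k² + s_{k-r+1} + ⋯ + s_k)) ∏_{i ∈ T} (factor i) (-q^(1 + 2 s_k); q²)_∞`
divided by `(q²; q²)_{s_1 - s_2} ⋯ (q²; q²)_{s_{k-1} - s_k} (q²; q²)_{s_k}`. -/
noncomputable def bggTerm (q : ℂ) (k r : ℕ) (T : Finset ℕ) (s : DecTuple k) : ℂ :=
  q ^ (2 * (∑ i ∈ Finset.Icc 1 k, s.entry i ^ 2 + ∑ i ∈ Finset.Icc (k - r + 1) k, s.entry i))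
      * (∏ i ∈ T, bggFactor q s i)
      * qPochInf (-q ^ (1 + 2 * s.entry k)) (q ^ 2)
    / ((∏ i ∈ Finset.Icc 1 (k - 1), qPoch (q ^ 2) (q ^ 2) (s.entry i - s.entry (i + 1)))
      * qPoch (q ^ 2) (q ^ 2) (s.entry k))

/-- The product side
`(-q³; q²)_∞ / (q²; q²)_∞ * ∑_{s=0}^{j} C(j, s) *
  ((q^(4k+4), q^(2k+3-2r+2j-4s), q^(2k+1+2r-2j+4s); q^(4k+4))_∞
    + q (q^(4k+4), q^(2k+1-2r+2j-4s), q^(2k+3+2r-2j+4s); q^(4k+4))_∞)`. -/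
noncomputable def bggProductSide (q : ℂ) (k r j : ℕ) : ℂ :=
  qPochInf (-q ^ 3) (q ^ 2) / qPochInf (q ^ 2) (q ^ 2) *
    ∑ s ∈ Finset.range (j + 1), (j.choose s : ℂ) *
      (qPochInf3 (q ^ (4 * k + 4))
          (q ^ (2 * k + 3 - 2 * r + 2 * j - 4 * s : ℤ))
          (q ^ (2 * k + 1 + 2 * r - 2 * j + 4 * s : ℤ)) (q ^ (4 * k + 4))
        + q * qPochInf3 (q ^ (4 * k + 4))
          (q ^ (2 * k + 1 - 2 * r + 2 * j - 4 * s : ℤ))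
          (q ^ (2 * k + 3 + 2 * r - 2 * j + 4 * s : ℤ)) (q ^ (4 * k + 4)))

open Filter Topology

/-! ### q-Pochhammer symbols -/

/-! Put `Q = q²`. The proof iterates the Bailey lemma in bilateral form: a pair relative to `Q^c`
satisfies `β_n = ∑_{m ∈ ℤ} α_m / ((Q;Q)_{n-m} (Q;Q)_{n+c+m})`. A plain step multiplies `α_m` by
`Q^(m² + cm)` and adds one summation variable to `β` (`sum_bailey_kernel`). For `c = 0`, a step
weighted by `Q^x + Q^(-y)` contributes the further factor `Q^m + Q^(-m)`
(`sum_weighted_bailey_kernel`). The seed `isBaileyPair_initial` has an `α` antisymmetric under `m ↦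
-1 - m`, so it is a pair for `c = 0` and `c = 1` at once (`isBaileyPair_zero_iff_one`). The `r`
innermost steps use `c = 1` and create the linear terms `s_{k-r+1} + ⋯ + s_k`; the `k - r` outer
steps use `c = 0` and carry the weights. Multipliers of `α` commute, so only the number `j` of
weighted steps matters, not their positions. As `n → ∞`, the `β` side becomes the multisum. On the
`α` side, `(Q^m + Q^(-m))^j` is expanded binomially and each theta series is a triple product. All
limits are by dominated convergence; `HasSum` over `ℂ` includes absolute convergence. -/

theorem one_sub_mul_pow_ne_zero {a q : ℂ} (hq : ‖q‖ < 1) (ha : ‖a‖ < 1) (i : ℕ) :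
    1 - a * q ^ i ≠ 0 := by
  intro h
  have h1 : ‖a * q ^ i‖ = 1 := by rw [← sub_eq_zero.mp h, norm_one]
  rw [norm_mul, norm_pow] at h1
  have h2 : ‖q‖ ^ i ≤ 1 := pow_le_one₀ (norm_nonneg _) hq.le
  nlinarith [norm_nonneg a, mul_le_mul_of_nonneg_left h2 (norm_nonneg a)]

theorem qPoch_ne_zero {a q : ℂ} (hq : ‖q‖ < 1) (ha : ‖a‖ < 1) (n : ℕ) : qPoch a q n ≠ 0 :=
  Finset.prod_ne_zero_iff.mpr fun i _ => one_sub_mul_pow_ne_zero hq ha i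

theorem qPochInf_ne_zero {a q : ℂ} (hq : ‖q‖ < 1) (ha : ‖a‖ < 1) : qPochInf a q ≠ 0 := by
  have h := tprod_one_add_ne_zero_of_summable (f := fun i : ℕ => -(a * q ^ i))
    (fun i => by simpa only [sub_eq_add_neg] using one_sub_mul_pow_ne_zero hq ha i)
    (by
      simp only [norm_neg, norm_mul, norm_pow]
      exact (summable_geometric_of_lt_one (norm_nonneg q) hq).mul_left _)
  simpa only [qPochInf, sub_eq_add_neg] using h

theorem qPoch_succ (a q : ℂ) (n : ℕ) : qPoch a q (n + 1) = qPoch a q n * (1 - a * q ^ n) :=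
  Finset.prod_range_succ _ _

theorem tendsto_qPoch (a : ℂ) {q : ℂ} (hq : ‖q‖ < 1) :
    Tendsto (qPoch a q) atTop (𝓝 (qPochInf a q)) :=
  (multipliable_qPochInf a q hq).hasProd.tendsto_prod_nat

theorem qPoch_mul_qPochInf (a : ℂ) {q : ℂ} (hq : ‖q‖ < 1) (n : ℕ) :
    qPoch a q n * qPochInf (a * q ^ n) q = qPochInf a q := by
  have h : Tendsto (fun l => qPoch a q n * qPoch (a * q ^ n) q l) atTop (𝓝 (qPochInf a q)) := by
    have h1 := (tendsto_qPoch a hq).comp (tendsto_add_atTop_nat n)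
    refine h1.congr fun l => ?_
    simp only [Function.comp, qPoch]
    rw [add_comm l n, Finset.prod_range_add]
    simp only [pow_add, mul_assoc]
  exact tendsto_nhds_unique ((tendsto_qPoch _ hq).const_mul _) h

/-! ### Reciprocals of `(q; q)_n` with integer index -/

/-- `1 / (q; q)_n`, extended by `0` to negative `n`. -/
noncomputable def invPoch (q : ℂ) (n : ℤ) : ℂ :=
  if n < 0 then 0 else (qPoch q q n.toNat)⁻¹

theorem invPoch_of_neg (q : ℂ) {n : ℤ} (hn : n < 0) : invPoch q n = 0 := if_pos hn

theorem invPoch_natCast (q : ℂ) (n : ℕ) : invPoch q n = (qPoch q q n)⁻¹ := by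
  simp [invPoch]

theorem invPoch_zero (q : ℂ) : invPoch q 0 = 1 := by simp [invPoch, qPoch]

/-- The zero extension makes this recurrence valid for every integer: at `n = 0` the factor `1 -
q^0` vanishes. All contiguity arguments below rest on it. -/
theorem invPoch_sub_one {q : ℂ} (hq : ‖q‖ < 1) (n : ℤ) :
    invPoch q (n - 1) = (1 - q ^ n) * invPoch q n := by
  rcases lt_trichotomy n 0 with h | rfl | h
  · rw [invPoch_of_neg q h, invPoch_of_neg q (by omega), mul_zero]
  · rw [invPoch_of_neg q (by omega)]; simp
  · obtain ⟨k, rfl⟩ : ∃ k : ℕ, n = (k + 1 : ℕ) := ⟨n.toNat - 1, by omega⟩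
    have h1 : ((k + 1 : ℕ) : ℤ) - 1 = (k : ℕ) := by push_cast; ring
    rw [h1, invPoch_natCast, invPoch_natCast, qPoch_succ, zpow_natCast]
    have h2 := one_sub_mul_pow_ne_zero hq hq k
    have h3 := qPoch_ne_zero hq hq k
    rw [pow_succ' q k]
    field_simp

theorem tendsto_invPoch {q : ℂ} (hq : ‖q‖ < 1) :
    Tendsto (invPoch q) atTop (𝓝 (qPochInf q q)⁻¹) := by
  have h : Tendsto (fun n : ℤ => (qPoch q q n.toNat)⁻¹) atTop (𝓝 (qPochInf q q)⁻¹) :=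
    ((tendsto_qPoch q hq).comp
      (tendsto_atTop.mpr fun b => by
        filter_upwards [eventually_ge_atTop (b : ℤ)] with n hn; omega)).inv₀
      (qPochInf_ne_zero hq hq)
  refine h.congr' ?_
  filter_upwards [eventually_ge_atTop 0] with n hn
  rw [invPoch, if_neg (by omega)]

theorem exists_norm_le_of_tendsto {u : ℕ → ℂ} {l : ℂ} (h : Tendsto u atTop (𝓝 l)) :
    ∃ C : ℝ, 1 ≤ C ∧ ∀ n, ‖u n‖ ≤ C := by
  obtain ⟨C, hC⟩ := (Metric.isBounded_range_of_tendsto u h).exists_norm_le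
  exact ⟨max C 1, le_max_right _ _, fun n => (hC _ ⟨n, rfl⟩).trans (le_max_left _ _)⟩

theorem exists_norm_invPoch_le {q : ℂ} (hq : ‖q‖ < 1) :
    ∃ C : ℝ, 1 ≤ C ∧ ∀ n, ‖invPoch q n‖ ≤ C := by
  obtain ⟨C, hC1, hC⟩ := exists_norm_le_of_tendsto
    ((tendsto_qPoch q hq).inv₀ (qPochInf_ne_zero hq hq))
  refine ⟨C, hC1, fun n => ?_⟩
  rw [invPoch]
  split_ifs
  · rw [norm_zero]; linarith
  · exact hC _

/-! ### Summability of theta series -/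

theorem summable_nat_theta {z p : ℂ} (hz : z ≠ 0) (hp0 : p ≠ 0) (hp : ‖p‖ < 1) :
    Summable fun n : ℕ => z ^ n * p ^ (n ^ 2) := by
  refine summable_of_ratio_test_tendsto_lt_one (l := 0) one_pos
    (Eventually.of_forall fun n => mul_ne_zero (pow_ne_zero _ hz) (pow_ne_zero _ hp0)) ?_
  have h : Tendsto (fun n : ℕ => (‖z‖ * ‖p‖) * (‖p‖ ^ n * ‖p‖ ^ n)) atTop (𝓝 0) := by
    have h1 := tendsto_pow_atTop_nhds_zero_of_lt_one (norm_nonneg p) hp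
    simpa using (h1.mul h1).const_mul (‖z‖ * ‖p‖)
  refine h.congr fun n => ?_
  have hz' := norm_ne_zero_iff.mpr hz
  have hp' := norm_ne_zero_iff.mpr hp0
  simp only [norm_mul, norm_pow]
  rw [eq_div_iff (mul_ne_zero (pow_ne_zero _ hz') (pow_ne_zero _ hp'))]
  ring

theorem summable_int_theta {z p : ℂ} (hz : z ≠ 0) (hp0 : p ≠ 0) (hp : ‖p‖ < 1) :
    Summable fun m : ℤ => z ^ m * p ^ (m ^ 2) := by
  refine Summable.of_nat_of_neg ?_ ?_
  · refine (summable_nat_theta hz hp0 hp).congr fun n => ?_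
    rw [zpow_natCast, ← Nat.cast_pow, zpow_natCast]
  · refine (summable_nat_theta (inv_ne_zero hz) hp0 hp).congr fun n => ?_
    rw [neg_sq, zpow_neg, zpow_natCast, ← Nat.cast_pow, zpow_natCast, inv_pow]

theorem HasSum.of_eq {ι : Type*} {f g : ι → ℂ} {a b : ℂ} (h : HasSum f a) (hf : ∀ i, g i = f i)
    (ha : b = a) : HasSum g b := by
  rw [ha, show g = f from funext hf]
  exact h

/-! ### Finitely supported sums against products of reciprocals -/

/-- The reciprocals vanish outside `-b ≤ m ≤ a`, so no condition on `f` is needed. -/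
theorem summable_mul_invPoch (q : ℂ) (f : ℤ → ℂ) (a b : ℤ) :
    Summable fun m : ℤ => f m * (invPoch q (a - m) * invPoch q (b + m)) := by
  refine summable_of_ne_finset_zero (s := Finset.Icc (-b) a) fun m hm => ?_
  rw [Finset.mem_Icc, not_and_or] at hm
  rcases hm with h | h
  · rw [invPoch_of_neg q (n := b + m) (by omega), mul_zero, mul_zero]
  · rw [invPoch_of_neg q (n := a - m) (by omega), zero_mul, mul_zero]

theorem tendsto_tsum_mul_invPoch {q : ℂ} (hq : ‖q‖ < 1) {f : ℤ → ℂ} (hf : Summable f) :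
    Tendsto (fun n : ℕ => ∑' m : ℤ, f m * (invPoch q (n - m) * invPoch q (n + m))) atTop
      (𝓝 ((∑' m, f m) * ((qPochInf q q)⁻¹ * (qPochInf q q)⁻¹))) := by
  obtain ⟨C, hC1, hC⟩ := exists_norm_invPoch_le hq
  rw [← tsum_mul_right]
  refine tendsto_tsum_of_dominated_convergence (bound := fun m => ‖f m‖ * (C * C))
    (hf.norm.mul_right _) (fun m => ?_) (Eventually.of_forall fun n m => ?_)
  · refine Tendsto.const_mul _ (Tendsto.mul ?_ ?_)
    · exact (tendsto_invPoch hq).comp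
        (tendsto_atTop_add_const_right _ (-m) tendsto_natCast_atTop_atTop)
    · exact (tendsto_invPoch hq).comp
        (tendsto_atTop_add_const_right _ m tendsto_natCast_atTop_atTop)
  · rw [norm_mul, norm_mul]
    have := hC (n - m)
    have := hC (n + m)
    gcongr

/-! ### The Jacobi triple product -/

/-- With `P = p²`, row `n` plus `-z p^(2n+1)` times its shift by one is `1 - P^(n+l+1)` times row `n
+ 1`, by `(1 - x) + x(1 - y) = 1 - xy` with `x = P^(n+1-m)`, `y = P^(l+m)`. The constant `A` is left
free so that the lemma can be applied twice: with `l = 0` and `z⁻¹`, then, after `m ↦ -m`, that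
result is the base case for `z`. -/
theorem hasSum_finite_triple_product_aux {z p : ℂ} (hz : z ≠ 0) (hp0 : p ≠ 0) (hp : ‖p‖ < 1)
    {l : ℕ} {A : ℂ}
    (h0 : HasSum (fun m : ℤ => (-z) ^ m * p ^ (m ^ 2) *
      (invPoch (p ^ 2) (0 - m) * invPoch (p ^ 2) (l + m))) (invPoch (p ^ 2) l * A)) (n : ℕ) :
    HasSum (fun m : ℤ => (-z) ^ m * p ^ (m ^ 2) *
      (invPoch (p ^ 2) (n - m) * invPoch (p ^ 2) (l + m)))
      (invPoch (p ^ 2) (n + l) * (A * qPoch (z * p) (p ^ 2) n)) := by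
  have hP : ‖p ^ 2‖ < 1 := by rw [norm_pow]; exact pow_lt_one₀ (norm_nonneg _) hp two_ne_zero
  induction n with
  | zero => simpa [qPoch] using h0
  | succ n ih =>
    have hne : 1 - (p ^ 2) ^ ((n : ℤ) + l + 1) ≠ 0 := by
      have := one_sub_mul_pow_ne_zero hP hP (n + l)
      rw [← pow_succ'] at this
      exact_mod_cast this
    have hrec := invPoch_sub_one hP ((n : ℤ) + l + 1)
    rw [add_sub_cancel_right] at hrec
    have hshift := ((Equiv.subRight (1 : ℤ)).hasSum_iff.mpr ih).mul_left (-z * p ^ (2 * n + 1))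
    have hsum := (ih.add hshift).mul_left (1 - (p ^ 2) ^ ((n : ℤ) + l + 1))⁻¹
    refine hsum.of_eq (fun m => ?_) ?_
    · simp only [Function.comp, Equiv.subRight_apply]
      have h1 := invPoch_sub_one hP (((n + 1 : ℕ) : ℤ) - m)
      have h2 := invPoch_sub_one hP ((l : ℤ) + m)
      rw [show ((n + 1 : ℕ) : ℤ) - m - 1 = n - m by push_cast; ring] at h1
      rw [show (n : ℤ) - (m - 1) = ((n + 1 : ℕ) : ℤ) - m by push_cast; ring,
        show (l : ℤ) + (m - 1) = l + m - 1 by ring, h1, h2, eq_inv_mul_iff_mul_eq₀ hne]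
      have h3 : (-z) ^ (m - 1) = (-z) ^ m * (-z)⁻¹ := by
        rw [zpow_sub_one₀ (neg_ne_zero.mpr hz)]
      have h4 : p ^ ((m - 1) ^ 2) * p ^ (2 * n + 1) =
          p ^ (m ^ 2) * (p ^ 2) ^ (((n + 1 : ℕ) : ℤ) - m) := by
        rw [← zpow_natCast p (2 * n + 1), ← zpow_natCast p 2, ← zpow_mul, ← zpow_add₀ hp0,
          ← zpow_add₀ hp0]
        congr 1; push_cast; ring
      have h5 : (p ^ 2) ^ (((n + 1 : ℕ) : ℤ) - m) * (p ^ 2) ^ ((l : ℤ) + m)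
          = (p ^ 2) ^ ((n : ℤ) + l + 1) := by
        rw [← zpow_add₀ (pow_ne_zero 2 hp0)]
        congr 1; push_cast; ring
      have h6 : -z * ((-z) ^ m * (-z)⁻¹) = (-z) ^ m := by
        field_simp
      rw [h3, ← h5]
      linear_combination
        (-((-z) ^ m * (-z)⁻¹) * -z * invPoch (p ^ 2) (((n + 1 : ℕ) : ℤ) - m)
          * ((1 - (p ^ 2) ^ ((l : ℤ) + m)) * invPoch (p ^ 2) ((l : ℤ) + m))) * h4
        - (p ^ (m ^ 2) * (p ^ 2) ^ (((n + 1 : ℕ) : ℤ) - m)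
          * invPoch (p ^ 2) (((n + 1 : ℕ) : ℤ) - m)
          * ((1 - (p ^ 2) ^ ((l : ℤ) + m)) * invPoch (p ^ 2) ((l : ℤ) + m))) * h6
    · rw [eq_inv_mul_iff_mul_eq₀ hne, hrec, qPoch_succ]
      push_cast
      rw [show (n : ℤ) + 1 + l = n + l + 1 by ring]
      ring

theorem hasSum_finite_triple_product {z p : ℂ} (hz : z ≠ 0) (hp0 : p ≠ 0) (hp : ‖p‖ < 1)
    (n : ℕ) :
    HasSum (fun m : ℤ => (-z) ^ m * p ^ (m ^ 2) *
      (invPoch (p ^ 2) (n - m) * invPoch (p ^ 2) (n + m)))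
      (invPoch (p ^ 2) (n + n) * (qPoch (p / z) (p ^ 2) n * qPoch (z * p) (p ^ 2) n)) := by
  refine hasSum_finite_triple_product_aux hz hp0 hp ?_ n
  have h00 : HasSum (fun m : ℤ => (-z⁻¹) ^ m * p ^ (m ^ 2) *
      (invPoch (p ^ 2) (0 - m) * invPoch (p ^ 2) ((0 : ℕ) + m))) (invPoch (p ^ 2) (0 : ℕ) * 1) := by
    refine (hasSum_single (0 : ℤ) ?_).of_eq (fun _ => rfl) ?_
    rotate_left
    · simp [invPoch_zero]
    · intro m hm
      rcases lt_or_gt_of_ne hm with h | h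
      · rw [invPoch_of_neg _ (n := (0 : ℕ) + m) (by simpa using h)]; simp
      · rw [invPoch_of_neg _ (n := 0 - m) (by omega)]; simp
  have h := hasSum_finite_triple_product_aux (inv_ne_zero hz) hp0 hp h00 n
  have h' := (Equiv.neg ℤ).hasSum_iff.mpr h
  refine h'.of_eq (fun m => ?_) ?_
  · simp only [Function.comp, Equiv.neg_apply, neg_sq]
    rw [zpow_neg, ← inv_zpow, inv_neg, inv_inv]
    simp only [zero_sub, sub_neg_eq_add, Nat.cast_zero, zero_add]
    ring
  · rw [one_mul, Nat.cast_zero, add_zero, div_eq_inv_mul]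

theorem hasSum_jacobi_triple_product {z p : ℂ} (hz : z ≠ 0) (hp0 : p ≠ 0) (hp : ‖p‖ < 1) :
    HasSum (fun m : ℤ => (-z) ^ m * p ^ (m ^ 2))
      (qPochInf3 (p ^ 2) (z * p) (p / z) (p ^ 2)) := by
  have hP : ‖p ^ 2‖ < 1 := by rw [norm_pow]; exact pow_lt_one₀ (norm_nonneg _) hp two_ne_zero
  have hs := summable_int_theta (neg_ne_zero.mpr hz) hp0 hp
  have h1 := tendsto_tsum_mul_invPoch hP hs
  simp_rw [(hasSum_finite_triple_product hz hp0 hp _).tsum_eq] at h1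
  have h2 : Tendsto (fun n : ℕ => invPoch (p ^ 2) (n + n) *
      (qPoch (p / z) (p ^ 2) n * qPoch (z * p) (p ^ 2) n)) atTop
      (𝓝 ((qPochInf (p ^ 2) (p ^ 2))⁻¹ *
        (qPochInf (p / z) (p ^ 2) * qPochInf (z * p) (p ^ 2)))) :=
    (((tendsto_invPoch hP).comp
      (tendsto_natCast_atTop_atTop.atTop_add_nonneg fun n => Int.natCast_nonneg n))).mul
      ((tendsto_qPoch _ hP).mul (tendsto_qPoch _ hP))
  have h3 := tendsto_nhds_unique h1 h2
  have h4 := qPochInf_ne_zero hP hP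
  have h5 : ∑' m : ℤ, (-z) ^ m * p ^ (m ^ 2) =
      qPochInf3 (p ^ 2) (z * p) (p / z) (p ^ 2) := by
    rw [qPochInf3]
    field_simp at h3
    rw [h3]; ring
  rw [← h5]
  exact hs.hasSum

/-! ### Bilateral Bailey pairs -/

/-- A Pascal-type recurrence: row `N + 1` combines row `N` for `M` with a shifted row `N` for `M +
1`, hence the induction for all `M`. -/
theorem hasSum_vandermonde_shifted {Q : ℂ} (hQ0 : Q ≠ 0) (hQ : ‖Q‖ < 1) (N : ℕ) (M : ℤ) :
    HasSum (fun t : ℤ => Q ^ (t * (t + M)) *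
      (invPoch Q (N - t) * invPoch Q t * invPoch Q (t + M)))
      (invPoch Q N * invPoch Q (N + M)) := by
  induction N generalizing M with
  | zero =>
    refine (hasSum_single (0 : ℤ) fun t ht => ?_).of_eq (fun _ => rfl) ?_
    · rcases lt_or_gt_of_ne ht with h | h
      · rw [invPoch_of_neg _ h]; simp
      · rw [invPoch_of_neg _ (n := ((0 : ℕ) : ℤ) - t) (by simpa using h)]; simp
    · simp [invPoch_zero]
  | succ N ih =>
    have hne : 1 - Q ^ ((N : ℤ) + 1) ≠ 0 := by
      have := one_sub_mul_pow_ne_zero hQ hQ N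
      rw [← pow_succ'] at this
      exact_mod_cast this
    have h1 := ih M
    have h2 := ((Equiv.subRight (1 : ℤ)).hasSum_iff.mpr (ih (M + 1))).mul_left (Q ^ ((N : ℤ) + 1 + M))
    refine ((h1.add h2).mul_left (1 - Q ^ ((N : ℤ) + 1))⁻¹).of_eq (fun t => ?_) ?_
    · simp only [Function.comp, Equiv.subRight_apply]
      have e1 := invPoch_sub_one hQ (((N + 1 : ℕ) : ℤ) - t)
      rw [show ((N + 1 : ℕ) : ℤ) - t - 1 = N - t by push_cast; ring] at e1
      rw [show (N : ℤ) - (t - 1) = ((N + 1 : ℕ) : ℤ) - t by push_cast; ring,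
        show t - 1 + (M + 1) = t + M by ring, e1, invPoch_sub_one hQ t,
        eq_inv_mul_iff_mul_eq₀ hne]
      have e2 : Q ^ ((N : ℤ) + 1 + M) * Q ^ ((t - 1) * (t + M)) =
          Q ^ (t * (t + M)) * Q ^ (((N + 1 : ℕ) : ℤ) - t) := by
        rw [← zpow_add₀ hQ0, ← zpow_add₀ hQ0]; congr 1; push_cast; ring
      have e3 : Q ^ ((N : ℤ) + 1) = Q ^ (((N + 1 : ℕ) : ℤ) - t) * Q ^ t := by
        rw [← zpow_add₀ hQ0]; congr 1; push_cast; ring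
      rw [e3]
      linear_combination
        (-(invPoch Q (((N + 1 : ℕ) : ℤ) - t) * ((1 - Q ^ t) * invPoch Q t)
          * invPoch Q (t + M))) * e2
    · rw [eq_inv_mul_iff_mul_eq₀ hne]
      have e1 := invPoch_sub_one hQ ((N : ℤ) + 1)
      have e2 := invPoch_sub_one hQ ((N : ℤ) + 1 + M)
      rw [add_sub_cancel_right] at e1
      rw [show (N : ℤ) + 1 + M - 1 = N + M by ring] at e2
      push_cast
      rw [show (N : ℤ) + (M + 1) = N + 1 + M by ring, e2, e1]
      ring

/-- The `q`-Chu-Vandermonde sum in symmetric form. -/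
theorem hasSum_vandermonde {Q : ℂ} (hQ0 : Q ≠ 0) (hQ : ‖Q‖ < 1) (n a b : ℤ) :
    HasSum (fun s : ℤ => Q ^ ((s - a) * (s - b)) *
      (invPoch Q (n - s) * invPoch Q (s - a) * invPoch Q (s - b)))
      (invPoch Q (n - a) * invPoch Q (n - b)) := by
  rcases lt_or_ge n a with h | h
  · rw [invPoch_of_neg Q (n := n - a) (by omega), zero_mul]
    refine hasSum_zero.of_eq (fun s => ?_) rfl
    rcases lt_or_ge n s with h' | h'
    · rw [invPoch_of_neg Q (n := n - s) (by omega)]; ring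
    · rw [invPoch_of_neg Q (n := s - a) (by omega)]; ring
  · obtain ⟨N, hN⟩ := Int.eq_ofNat_of_zero_le (show 0 ≤ n - a by omega)
    have h1 := (Equiv.subRight a).hasSum_iff.mpr (hasSum_vandermonde_shifted hQ0 hQ N (a - b))
    refine h1.of_eq (fun s => ?_) ?_
    · simp only [Function.comp, Equiv.subRight_apply]
      rw [← hN, show s - a + (a - b) = s - b by ring, show n - a - (s - a) = n - s by ring]
    · rw [← hN, show n - a + (a - b) = n - b by ring]

/-- A term with `s < 0` survives only if `a ≤ s` and `b ≤ s`, which forces `a + b ≤ -2`; so the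
bilateral sum reduces to `0 ≤ s ≤ n`. -/
theorem sum_vandermonde {Q : ℂ} (hQ0 : Q ≠ 0) (hQ : ‖Q‖ < 1) (n : ℕ) (a b : ℤ) (hab : -1 ≤ a + b) :
    ∑ y ∈ Finset.range (n + 1), Q ^ (((y : ℤ) - a) * (y - b)) *
      (invPoch Q (n - y) * invPoch Q (y - a) * invPoch Q (y - b)) =
      invPoch Q (n - a) * invPoch Q (n - b) := by
  have h := hasSum_vandermonde hQ0 hQ n a b
  rw [← (Nat.cast_injective (R := ℤ)).hasSum_iff (fun s hs => ?_)] at h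
  · refine (hasSum_sum_of_ne_finset_zero fun y hy => ?_).unique h
    rw [Finset.mem_range] at hy
    rw [invPoch_of_neg Q (n := (n : ℤ) - y) (by omega)]; ring
  · have hs' : s < 0 := by
      by_contra h0
      exact hs ⟨s.toNat, by simp; omega⟩
    rcases lt_or_ge s a with h' | h'
    · rw [invPoch_of_neg Q (n := s - a) (by omega)]; ring
    · rw [invPoch_of_neg Q (n := s - b) (by omega)]; ring

/-- `(α, β)` is a bilateral Bailey pair relative to `Q ^ c`. -/
def IsBaileyPair (Q : ℂ) (c : ℤ) (α : ℤ → ℂ) (β : ℕ → ℂ) : Prop :=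
  ∀ n : ℕ, HasSum (fun m : ℤ => α m * (invPoch Q (n - m) * invPoch Q (n + c + m))) (β n)

/-- The hypothesis says that `y ↦ 1 / ((Q;Q)_{y-m} (Q;Q)_{y+c+m})` is an eigenvector of `g` with
eigenvalue `μ m`; the finite sum over `y` is then exchanged with the sum over `m`. -/
theorem IsBaileyPair.step {Q : ℂ} {c : ℤ} {α : ℤ → ℂ} {β : ℕ → ℂ} (h : IsBaileyPair Q c α β)
    {g : ℕ → ℕ → ℂ} {μ : ℤ → ℂ}
    (hg : ∀ (n : ℕ) (m : ℤ), ∑ y ∈ Finset.range (n + 1),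
      g n y * (invPoch Q (y - m) * invPoch Q (y + c + m)) =
        μ m * (invPoch Q (n - m) * invPoch Q (n + c + m))) :
    IsBaileyPair Q c (fun m => μ m * α m)
      (fun n => ∑ y ∈ Finset.range (n + 1), g n y * β y) := by
  intro n
  refine (hasSum_sum fun y _ => (h y).mul_left (g n y)).of_eq (fun m => ?_) rfl
  rw [mul_right_comm, ← hg, Finset.sum_mul]
  exact Finset.sum_congr rfl fun y _ => by ring

/-- Chu-Vandermonde with `a = m`, `b = -c - m`, since `y(y + c) = m(m + c) + (y - m)(y + c + m)`.
The bound `c ≤ 1` is exactly `-1 ≤ a + b`. -/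
theorem sum_bailey_kernel {Q : ℂ} (hQ0 : Q ≠ 0) (hQ : ‖Q‖ < 1) {c : ℤ} (hc : c ≤ 1) (n : ℕ)
    (m : ℤ) :
    ∑ y ∈ Finset.range (n + 1), Q ^ ((y : ℤ) * (y + c)) * invPoch Q (n - y) *
      (invPoch Q (y - m) * invPoch Q (y + c + m)) =
        Q ^ (m * (m + c)) * (invPoch Q (n - m) * invPoch Q (n + c + m)) := by
  have h := sum_vandermonde hQ0 hQ n m (-c - m) (by omega)
  rw [show (n : ℤ) - (-c - m) = n + c + m by ring] at h
  rw [← h, Finset.mul_sum]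
  refine Finset.sum_congr rfl fun y _ => ?_
  rw [show (y : ℤ) - (-c - m) = y + c + m by ring,
    show (y : ℤ) * (y + c) = m * (m + c) + (y - m) * (y + c + m) by ring, zpow_add₀ hQ0]
  ring

/-- Write `Q^(-y) = Q^(-m) + Q^(-y) (1 - Q^(y-m))`. The last factor lowers `(Q;Q)_{y-m}` to
`(Q;Q)_{y-m-1}`, so two Chu-Vandermonde sums remain; in their total the terms with `Q^n` cancel and
`Q^m + Q^(-m)` is left. -/
theorem sum_weighted_bailey_kernel {Q : ℂ} (hQ0 : Q ≠ 0) (hQ : ‖Q‖ < 1) (n : ℕ) (m : ℤ) :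
    ∑ y ∈ Finset.range (n + 1), Q ^ ((y : ℤ) * (y + 0)) * (Q ^ (n : ℤ) + Q ^ (-(y : ℤ)))
        * invPoch Q (n - y) * (invPoch Q (y - m) * invPoch Q (y + 0 + m)) =
      Q ^ (m * (m + 0)) * (Q ^ m + Q ^ (-m)) * (invPoch Q (n - m) * invPoch Q (n + 0 + m)) := by
  have h1 := sum_bailey_kernel hQ0 hQ zero_le_one n m
  have h2 := sum_vandermonde hQ0 hQ n (m + 1) (-m) (by omega)
  have h3 : ∑ y ∈ Finset.range (n + 1), Q ^ ((y : ℤ) * (y + 0)) * (Q ^ (n : ℤ) + Q ^ (-(y : ℤ)))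
        * invPoch Q (n - y) * (invPoch Q (y - m) * invPoch Q (y + 0 + m)) =
      (Q ^ (n : ℤ) + Q ^ (-m)) * ∑ y ∈ Finset.range (n + 1), Q ^ ((y : ℤ) * (y + 0))
          * invPoch Q (n - y) * (invPoch Q (y - m) * invPoch Q (y + 0 + m))
      + Q ^ (m * (m + 1)) * ∑ y ∈ Finset.range (n + 1), Q ^ (((y : ℤ) - (m + 1)) * (y - -m)) *
      (invPoch Q (n - y) * invPoch Q (y - (m + 1)) * invPoch Q (y - -m)) := by
    rw [Finset.mul_sum, Finset.mul_sum, ← Finset.sum_add_distrib]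
    refine Finset.sum_congr rfl fun y _ => ?_
    have e1 := invPoch_sub_one hQ ((y : ℤ) - m)
    rw [show (y : ℤ) - m - 1 = y - (m + 1) by ring] at e1
    rw [e1, show (y : ℤ) - -m = y + 0 + m by ring]
    have e2 : Q ^ (m * (m + 1)) * Q ^ (((y : ℤ) - (m + 1)) * (y + 0 + m)) =
        Q ^ ((y : ℤ) * (y + 0)) * Q ^ (-(y : ℤ)) := by
      rw [← zpow_add₀ hQ0, ← zpow_add₀ hQ0]; congr 1; ring
    have e3 : Q ^ (-(y : ℤ)) * Q ^ ((y : ℤ) - m) = Q ^ (-m) := by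
      rw [← zpow_add₀ hQ0]; congr 1; ring
    linear_combination
      (-(invPoch Q (n - y) * ((1 - Q ^ ((y : ℤ) - m)) * invPoch Q (y - m)) *
        invPoch Q (y + 0 + m))) * e2
      + (Q ^ ((y : ℤ) * (y + 0)) * invPoch Q (n - y) * invPoch Q (y - m) *
        invPoch Q (y + 0 + m)) * e3
  rw [h3, h1, h2]
  have e1 := invPoch_sub_one hQ ((n : ℤ) - m)
  rw [show (n : ℤ) - m - 1 = n - (m + 1) by ring] at e1
  rw [e1, show (n : ℤ) - -m = n + 0 + m by ring]
  have e2 : Q ^ (m * (m + 1)) = Q ^ (m * (m + 0)) * Q ^ m := by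
    rw [← zpow_add₀ hQ0]; congr 1; ring
  have e3 : Q ^ m * Q ^ ((n : ℤ) - m) = Q ^ (n : ℤ) := by
    rw [← zpow_add₀ hQ0]; congr 1; ring
  rw [e2]
  linear_combination
    (-(Q ^ (m * (m + 0)) * invPoch Q (n - m) * invPoch Q (n + 0 + m))) * e3

theorem tsum_eq_zero_of_antisymm {f : ℤ → ℂ} (e : ℤ ≃ ℤ) (h : ∀ m, f (e m) = -f m) :
    ∑' m, f m = 0 := by
  have h1 := e.tsum_eq f
  simp_rw [h, tsum_neg] at h1
  exact self_eq_neg.mp h1.symm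

/-- For an antisymmetric sequence `α`, the Bailey pairs relative to `1` and `Q` agree. -/
theorem isBaileyPair_zero_iff_one {Q : ℂ} (hQ0 : Q ≠ 0) (hQ : ‖Q‖ < 1) {α : ℤ → ℂ} {β : ℕ → ℂ}
    (hα : ∀ m, α (-1 - m) = -Q ^ (2 * m + 1) * α m) :
    IsBaileyPair Q 0 α β ↔ IsBaileyPair Q 1 α β := by
  refine forall_congr' fun n => ?_
  -- This is the difference of the two defining sums, because `1/(Q;Q)_{n+m} = (1 - Q^(n+1+m)) /
  -- (Q;Q)_{n+1+m}`. The reflection `m ↦ -1 - m` swaps the two reciprocals and negates the summand.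
  have h1 : HasSum (fun m : ℤ => α m * Q ^ ((n : ℤ) + 1 + m) *
      (invPoch Q (n - m) * invPoch Q (n + 1 + m))) 0 := by
    have hs := summable_mul_invPoch Q (fun m => α m * Q ^ ((n : ℤ) + 1 + m)) n (n + 1)
    rw [← tsum_eq_zero_of_antisymm (Equiv.subLeft (-1 : ℤ)) (f := fun m : ℤ =>
      α m * Q ^ ((n : ℤ) + 1 + m) * (invPoch Q (n - m) * invPoch Q (n + 1 + m))) ?_]
    · exact hs.hasSum
    · intro m
      simp only [Equiv.subLeft_apply]
      rw [hα, show (n : ℤ) - (-1 - m) = n + 1 + m by ring,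
        show (n : ℤ) + 1 + (-1 - m) = n - m by ring,
        show (n : ℤ) + 1 + m = (2 * m + 1) + (n - m) by ring, zpow_add₀ hQ0 (2 * m + 1)]
      ring
  have e : ∀ m : ℤ, α m * (invPoch Q (n - m) * invPoch Q (n + 0 + m)) =
      α m * (invPoch Q (n - m) * invPoch Q (n + 1 + m)) -
        α m * Q ^ ((n : ℤ) + 1 + m) * (invPoch Q (n - m) * invPoch Q (n + 1 + m)) := by
    intro m
    have := invPoch_sub_one hQ ((n : ℤ) + 1 + m)
    rw [show (n : ℤ) + 1 + m - 1 = n + 0 + m by ring] at this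
    rw [this]; ring
  constructor
  · intro h
    exact (h.add h1).of_eq (fun m => by rw [e]; ring) (by ring)
  · intro h
    exact (h.sub h1).of_eq e (by ring)

/-! ### The initial Bailey pair -/

theorem norm_sq_lt_one {q : ℂ} (hq : ‖q‖ < 1) : ‖q ^ 2‖ < 1 := by
  rw [norm_pow]; exact pow_lt_one₀ (norm_nonneg _) hq two_ne_zero

/-- Induction on `n`. With `X = Q^(n+1)`, the summand of row `n + 1` times `(1 - X)(1 + X/q)` equals
the summand of row `n` plus a telescoping term plus one that is odd under `m ↦ -m`; the last two sum
to zero. -/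
theorem hasSum_initial {q : ℂ} (hq0 : q ≠ 0) (hq : ‖q‖ < 1) (n : ℕ) :
    HasSum (fun m : ℤ => (-1) ^ m * q ^ (2 * m ^ 2 - m) *
      (invPoch (q ^ 2) (n - m) * invPoch (q ^ 2) (n + m)))
      (invPoch (q ^ 2) n * (qPoch (-q) (q ^ 2) n)⁻¹) := by
  have hQ := norm_sq_lt_one hq
  have hQ0 : q ^ 2 ≠ 0 := pow_ne_zero 2 hq0
  induction n with
  | zero =>
    refine (hasSum_single (0 : ℤ) fun t ht => ?_).of_eq (fun _ => rfl) ?_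
    · rcases lt_or_gt_of_ne ht with h | h
      · rw [invPoch_of_neg _ (n := ((0 : ℕ) : ℤ) + t) (by simpa using h)]; simp
      · rw [invPoch_of_neg _ (n := ((0 : ℕ) : ℤ) - t) (by simpa using h)]; simp
    · simp [invPoch_zero, qPoch]
  | succ n ih =>
    set B : ℤ → ℂ := fun m =>
      invPoch (q ^ 2) ((n + 1 : ℕ) - m) * invPoch (q ^ 2) ((n + 1 : ℕ) + m) with hB
    set a : ℤ → ℂ := fun m => (-1) ^ m * q ^ (2 * m ^ 2 - m) with ha
    set X : ℂ := (q ^ 2) ^ ((n + 1 : ℕ) : ℤ) with hX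
    have hne1 : 1 - X ≠ 0 := by
      have := one_sub_mul_pow_ne_zero hQ hQ n
      rwa [← pow_succ', ← zpow_natCast] at this
    have hne2 : 1 + X / q ≠ 0 := by
      have := one_sub_mul_pow_ne_zero hQ (a := -q) (by rwa [norm_neg]) n
      have e : X / q = q * (q ^ 2) ^ n := by
        rw [hX, zpow_natCast, pow_succ]; field_simp
      rw [e]; simpa using this
    have hB1 : ∀ m : ℤ, invPoch (q ^ 2) (n - m) * invPoch (q ^ 2) (n + m) =
        (1 - X * (q ^ 2) ^ (-m)) * (1 - X * (q ^ 2) ^ m) * B m := by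
      intro m
      have e1 := invPoch_sub_one hQ (((n + 1 : ℕ) : ℤ) - m)
      have e2 := invPoch_sub_one hQ (((n + 1 : ℕ) : ℤ) + m)
      rw [show ((n + 1 : ℕ) : ℤ) - m - 1 = n - m by push_cast; ring,
        sub_eq_add_neg ((n + 1 : ℕ) : ℤ) m, zpow_add₀ hQ0, ← sub_eq_add_neg] at e1
      rw [show ((n + 1 : ℕ) : ℤ) + m - 1 = n + m by push_cast; ring, zpow_add₀ hQ0] at e2
      rw [e1, e2]; ring
    have hBs : ∀ m, (1 - X * (q ^ 2) ^ (m + 1)) * B (m + 1) = (1 - X * (q ^ 2) ^ (-m)) * B m := by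
      intro m
      have e1 := invPoch_sub_one hQ (((n + 1 : ℕ) : ℤ) - m)
      have e2 := invPoch_sub_one hQ (((n + 1 : ℕ) : ℤ) + (m + 1))
      rw [sub_eq_add_neg ((n + 1 : ℕ) : ℤ) m, zpow_add₀ hQ0, ← sub_eq_add_neg] at e1
      rw [zpow_add₀ hQ0] at e2
      simp only [hB]
      rw [show ((n + 1 : ℕ) : ℤ) - (m + 1) = (n + 1 : ℕ) - m - 1 by ring, e1]
      rw [show ((n + 1 : ℕ) : ℤ) + (m + 1) - 1 = (n + 1 : ℕ) + m by ring] at e2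
      rw [e2]; ring
    have has : ∀ m, a (m + 1) = -(q * (q ^ 2) ^ (2 * m)) * a m := by
      intro m
      simp only [ha]
      rw [show 2 * (m + 1) ^ 2 - (m + 1) = (2 * m ^ 2 - m) + (1 + 4 * m) by ring,
        zpow_add₀ hq0, zpow_add₀ hq0, zpow_one, zpow_add_one₀ (by norm_num), ← zpow_natCast q 2,
        ← zpow_mul, show ((2 : ℕ) : ℤ) * (2 * m) = 4 * m by push_cast; ring]
      ring
    have han : ∀ m, a (-m) = (q ^ 2) ^ m * a m := by
      intro m
      simp only [ha]
      rw [show 2 * (-m) ^ 2 - (-m) = 2 * m + (2 * m ^ 2 - m) by ring, zpow_add₀ hq0,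
        zpow_neg, ← inv_zpow, inv_neg, inv_one, ← zpow_natCast q 2, ← zpow_mul, Nat.cast_ofNat]
      ring
    have hBn : ∀ m, B (-m) = B m := by
      intro m
      simp only [hB]
      rw [sub_neg_eq_add, ← sub_eq_add_neg, mul_comm]
    have hsum : ∀ f : ℤ → ℂ, Summable fun m => f m * B m := fun f =>
      summable_mul_invPoch (q ^ 2) f (n + 1 : ℕ) (n + 1 : ℕ)
    -- the telescoping part
    have hT : HasSum (fun m => a m * (X * (q ^ 2) ^ m / q + X * (q ^ 2) ^ (-m)
        - X ^ 2 * (1 + 1 / q)) * B m) 0 := by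
      -- Telescoping certificate: the summand of `hT` is `G(m+1) - G(m)` for this finitely supported
      -- `G`.
      have hG := (hsum fun m => -(a m * (1 - X * (q ^ 2) ^ m) * (X * (q ^ 2) ^ (-m)))).hasSum
      have hG' := ((Equiv.addRight (1 : ℤ)).hasSum_iff.mpr hG).sub hG
      refine hG'.of_eq (fun m => ?_) (by ring)
      simp only [Function.comp, Equiv.coe_addRight]
      have e := hBs m
      have e' : -(a (m + 1) * (1 - X * (q ^ 2) ^ (m + 1)) * (X * (q ^ 2) ^ (-(m + 1)))) * B (m + 1)
          = -(a (m + 1) * (X * (q ^ 2) ^ (-(m + 1)))) * ((1 - X * (q ^ 2) ^ (-m)) * B m) := by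
        rw [← e]; ring
      rw [e', has, zpow_neg, zpow_neg, zpow_add_one₀ hQ0, mul_comm 2 m, zpow_mul]
      have hY : (q ^ 2) ^ m ≠ 0 := zpow_ne_zero _ hQ0
      generalize (q ^ 2) ^ m = Y at hY
      rw [zpow_ofNat]
      field_simp
      ring
    have hA : HasSum (fun m => a m * (1 - (q ^ 2) ^ m) * B m) 0 := by
      rw [← tsum_eq_zero_of_antisymm (Equiv.neg ℤ)
        (f := fun m => a m * (1 - (q ^ 2) ^ m) * B m) ?_]
      · exact (hsum _).hasSum
      · intro m
        simp only [Equiv.neg_apply]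
        rw [hBn, han, zpow_neg]
        have hY : (q ^ 2) ^ m ≠ 0 := zpow_ne_zero _ hQ0
        field_simp
        ring
    have htot := ((ih.add hT).add (hA.mul_left (X * (1 / q - 1)))).mul_left
      ((1 - X)⁻¹ * (1 + X / q)⁻¹)
    refine htot.of_eq (fun m => ?_) ?_
    · rw [hB1, ← mul_inv, eq_inv_mul_iff_mul_eq₀ (mul_ne_zero hne1 hne2), zpow_neg]
      change _ * (a m * B m) = a m * _ + _ + _
      have hY : (q ^ 2) ^ m ≠ 0 := zpow_ne_zero _ hQ0
      generalize (q ^ 2) ^ m = Y at hY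
      field_simp
      ring
    · rw [qPoch_succ, mul_zero, add_zero, add_zero]
      have e : (1 : ℂ) - -q * (q ^ 2) ^ n = 1 + X / q := by
        rw [hX, zpow_natCast, pow_succ]; field_simp; ring
      have e2 := invPoch_sub_one hQ ((n + 1 : ℕ) : ℤ)
      rw [show ((n + 1 : ℕ) : ℤ) - 1 = n by push_cast; ring] at e2
      rw [← hX] at e2
      rw [e, e2, mul_inv]
      field_simp

/-- The sequence `α` of the initial Bailey pair. -/
noncomputable def initialAlpha (q : ℂ) (m : ℤ) : ℂ :=
  (-1) ^ m * (q ^ (2 * m ^ 2 - m) + q ^ (2 * m ^ 2 + m + 1))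

/-- The sequence `β` of the initial Bailey pair. -/
noncomputable def initialBeta (q : ℂ) (n : ℕ) : ℂ :=
  (1 + q) * (invPoch (q ^ 2) n * (qPoch (-q) (q ^ 2) n)⁻¹)

/-- Adding `q` times the reflected identity multiplies the sum only by `1 + q`, and makes `α`
antisymmetric under `m ↦ -1 - m`, which exchanges the two powers of `q`. -/
theorem isBaileyPair_initial {q : ℂ} (hq0 : q ≠ 0) (hq : ‖q‖ < 1) :
    IsBaileyPair (q ^ 2) 0 (initialAlpha q) (initialBeta q) := by
  intro n
  have h := hasSum_initial hq0 hq n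
  have h' := ((Equiv.neg ℤ).hasSum_iff.mpr h).mul_left q
  refine (h.add h').of_eq (fun m => ?_) (by rw [initialBeta]; ring)
  simp only [Function.comp, Equiv.neg_apply, initialAlpha, neg_sq, sub_neg_eq_add, add_zero]
  rw [← sub_eq_add_neg, zpow_neg, ← inv_zpow, inv_neg, inv_one, zpow_add_one₀ hq0]
  ring

theorem initialAlpha_antisymm {q : ℂ} (hq0 : q ≠ 0) (m : ℤ) :
    initialAlpha q (-1 - m) = -(q ^ 2) ^ (2 * m + 1) * initialAlpha q m := by
  have h1 : (-1 : ℂ) ^ (-1 - m) = -(-1) ^ m := by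
    rw [sub_eq_add_neg, zpow_add₀ (by norm_num), zpow_neg _ m, ← inv_zpow, inv_neg, inv_one]
    simp
  have h2 : q ^ (2 * (-1 - m) ^ 2 - (-1 - m)) =
      (q ^ 2) ^ (2 * m + 1) * q ^ (2 * m ^ 2 + m + 1) := by
    rw [← zpow_natCast q 2, ← zpow_mul, ← zpow_add₀ hq0]; congr 1; push_cast; ring
  have h3 : q ^ (2 * (-1 - m) ^ 2 + (-1 - m) + 1) =
      (q ^ 2) ^ (2 * m + 1) * q ^ (2 * m ^ 2 - m) := by
    rw [← zpow_natCast q 2, ← zpow_mul, ← zpow_add₀ hq0]; congr 1; push_cast; ring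
  simp only [initialAlpha]
  rw [h1, h2, h3]
  ring

/-! ### Multisums along paths -/

/-- The product of the weights `g i (s i) (s (i + 1))` along the path `s`, times the weight `β` of
its last entry. -/
noncomputable def pathTerm (k : ℕ) (g : ℕ → ℕ → ℕ → ℂ) (β : ℕ → ℂ) (s : Fin (k + 1) → ℕ) : ℂ :=
  (∏ i : Fin k, g i (s i.castSucc) (s i.succ)) * β (s (Fin.last k))

theorem pathTerm_cons (k : ℕ) (g : ℕ → ℕ → ℕ → ℂ) (β : ℕ → ℂ) (n : ℕ) (s : Fin (k + 1) → ℕ) :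
    pathTerm (k + 1) g β (Fin.cons n s) =
      g 0 n (s 0) * pathTerm k (fun i => g (i + 1)) β s := by
  rw [pathTerm, pathTerm, Fin.prod_univ_succ, ← Fin.succ_last, Fin.cons_succ, mul_assoc]
  simp only [Fin.castSucc_zero, Fin.cons_zero, Fin.cons_succ, Fin.val_zero, Fin.val_succ,
    ← Fin.succ_castSucc]

theorem norm_pathTerm_cons_le {k : ℕ} {g : ℕ → ℕ → ℕ → ℂ} {β : ℕ → ℂ} {h : ℕ → ℝ} {C : ℝ}
    (hg : ∀ i x y, ‖g i x y‖ ≤ h y) (hβ : ∀ n, ‖β n‖ ≤ C) (n : ℕ) (s : Fin k → ℕ) :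
    ‖pathTerm k g β (Fin.cons n s)‖ ≤ (∏ i, h (s i)) * C := by
  rw [pathTerm, norm_mul, norm_prod]
  refine mul_le_mul (Finset.prod_le_prod (fun _ _ => norm_nonneg _) fun i _ => ?_) (hβ _)
    (norm_nonneg _) (Finset.prod_nonneg fun i _ => (norm_nonneg _).trans (hg 0 0 _))
  exact (hg _ _ _).trans_eq (by rw [Fin.cons_succ])

theorem summable_prod_fin {h : ℕ → ℝ} (h0 : ∀ n, 0 ≤ h n) (hh : Summable h) (k : ℕ) :
    Summable fun s : Fin k → ℕ => ∏ i, h (s i) := by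
  induction k with
  | zero => exact (hasSum_fintype _).summable
  | succ k ih =>
    rw [← (Fin.consEquiv fun _ => ℕ).summable_iff]
    refine (hh.mul_of_nonneg ih h0 fun s => Finset.prod_nonneg fun i _ => h0 _).congr fun x => ?_
    simp [Fin.consEquiv, Fin.prod_univ_succ]

theorem summable_pathTerm_cons {k : ℕ} {g : ℕ → ℕ → ℕ → ℂ} {β : ℕ → ℂ} {h : ℕ → ℝ} {C : ℝ}
    (hg : ∀ i x y, ‖g i x y‖ ≤ h y) (hh : Summable h) (hβ : ∀ n, ‖β n‖ ≤ C) (n : ℕ) :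
    Summable fun s : Fin k → ℕ => pathTerm k g β (Fin.cons n s) :=
  Summable.of_norm_bounded
    ((summable_prod_fin (fun y => (norm_nonneg _).trans (hg 0 0 y)) hh k).mul_right C)
    (norm_pathTerm_cons_le hg hβ n)

/-- Peeling off the first step turns the multisum into the finite sum over `y` produced by
`IsBaileyPair.step`. -/
theorem tsum_pathTerm_cons_succ {k : ℕ} {g : ℕ → ℕ → ℕ → ℂ} {β : ℕ → ℂ} {h : ℕ → ℝ} {C : ℝ}
    (hg : ∀ i x y, ‖g i x y‖ ≤ h y) (hh : Summable h) (hβ : ∀ n, ‖β n‖ ≤ C) (n : ℕ)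
    (h0 : ∀ y, n < y → g 0 n y = 0) :
    ∑' s : Fin (k + 1) → ℕ, pathTerm (k + 1) g β (Fin.cons n s) =
      ∑ y ∈ Finset.range (n + 1), g 0 n y *
        ∑' s : Fin k → ℕ, pathTerm k (fun i => g (i + 1)) β (Fin.cons y s) := by
  have hs := summable_pathTerm_cons (k := k + 1) hg hh hβ n
  rw [← (Fin.consEquiv fun _ => ℕ).summable_iff] at hs
  rw [← (Fin.consEquiv fun _ => ℕ).tsum_eq]
  have e := hs.tsum_prod
  simp only [Function.comp, Fin.consEquiv, Equiv.coe_fn_mk, pathTerm_cons, Fin.cons_zero,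
    tsum_mul_left] at e ⊢
  rw [e, tsum_eq_sum fun y hy => ?_]
  rw [h0 y (by simpa using hy), zero_mul]

theorem tendsto_tsum_pathTerm_cons {k : ℕ} {g : ℕ → ℕ → ℕ → ℂ} {G : ℕ → ℂ} {β : ℕ → ℂ}
    {h : ℕ → ℝ} {C : ℝ} (hg : ∀ i x y, ‖g i x y‖ ≤ h y) (hh : Summable h)
    (hβ : ∀ n, ‖β n‖ ≤ C) (hG : ∀ y, Tendsto (fun n => g 0 n y) atTop (𝓝 (G y))) :
    Summable (fun s : Fin (k + 1) → ℕ => G (s 0) * pathTerm k (fun i => g (i + 1)) β s) ∧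
    Tendsto (fun n => ∑' s : Fin (k + 1) → ℕ, pathTerm (k + 1) g β (Fin.cons n s)) atTop
      (𝓝 (∑' s : Fin (k + 1) → ℕ, G (s 0) * pathTerm k (fun i => g (i + 1)) β s)) := by
  have hb := (summable_prod_fin (fun y => (norm_nonneg _).trans (hg 0 0 y)) hh (k + 1)).mul_right C
  have hlim : ∀ s : Fin (k + 1) → ℕ,
      Tendsto (fun n => pathTerm (k + 1) g β (Fin.cons n s)) atTop
        (𝓝 (G (s 0) * pathTerm k (fun i => g (i + 1)) β s)) := fun s => by
    simp only [pathTerm_cons]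
    exact (hG _).mul_const _
  refine ⟨Summable.of_norm_bounded hb fun s => ?_, ?_⟩
  · exact le_of_tendsto (hlim s).norm
      (Eventually.of_forall fun n => norm_pathTerm_cons_le hg hβ n s)
  · exact tendsto_tsum_of_dominated_convergence hb hlim
      (Eventually.of_forall fun n s => norm_pathTerm_cons_le hg hβ n s)

/-! ### The kernels of the multisum -/

/-- The weight attached to the step from `x = s_i` to `y = s_{i + 1}`. The parameter `d` counts the
steps without the extra factor `Q ^ y`, and `w` marks those with weight `Q ^ x + Q ^ (-y)`. -/
noncomputable def bggKernel (Q : ℂ) (w : ℕ → Bool) (d i x y : ℕ) : ℂ :=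
  Q ^ ((y : ℤ) * y) * (if i < d then 1 else Q ^ (y : ℤ)) *
    (if i < d ∧ w i then Q ^ (x : ℤ) + Q ^ (-(y : ℤ)) else 1) * invPoch Q (x - y)

theorem bggKernel_succ (Q : ℂ) (w : ℕ → Bool) (d : ℕ) :
    (fun i => bggKernel Q w (d + 1) (i + 1)) = bggKernel Q (fun i => w (i + 1)) d := by
  funext i x y
  simp [bggKernel]

theorem bggKernel_zero_succ (Q : ℂ) (w : ℕ → Bool) :
    (fun i => bggKernel Q w 0 (i + 1)) = bggKernel Q w 0 := by
  funext i x y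
  simp [bggKernel]

theorem bggKernel_of_lt (Q : ℂ) (w : ℕ → Bool) (d i : ℕ) {x y : ℕ} (h : x < y) :
    bggKernel Q w d i x y = 0 := by
  rw [bggKernel, invPoch_of_neg Q (by omega), mul_zero]

/-- The weight is at most `2|Q|^(-y)`, which `Q^(y²)` absorbs. Uniformity in `x` is what lets the
starting point tend to infinity under the sum. -/
theorem exists_norm_bggKernel_le {Q : ℂ} (hQ0 : Q ≠ 0) (hQ : ‖Q‖ < 1) :
    ∃ h : ℕ → ℝ, Summable h ∧ ∀ w d i x y, ‖bggKernel Q w d i x y‖ ≤ h y := by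
  obtain ⟨C, hC1, hC⟩ := exists_norm_invPoch_le hQ
  refine ⟨fun y => ‖Q⁻¹ ^ y * Q ^ (y ^ 2)‖ * (2 * C),
    (summable_nat_theta (inv_ne_zero hQ0) hQ0 hQ).norm.mul_right _, fun w d i x y => ?_⟩
  have hpos : 0 < ‖Q‖ ^ y := pow_pos (norm_pos_iff.mpr hQ0) y
  have hle : ‖Q‖ ^ y ≤ 1 := pow_le_one₀ (norm_nonneg _) hQ.le
  have hinv : 1 ≤ (‖Q‖ ^ y)⁻¹ := (one_le_inv₀ hpos).mpr hle
  have h1 : ‖(if i < d then 1 else Q ^ (y : ℤ))‖ ≤ 1 := by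
    split_ifs
    · simp
    · rwa [zpow_natCast, norm_pow]
  have h2 : ‖(if i < d ∧ w i then Q ^ (x : ℤ) + Q ^ (-(y : ℤ)) else 1)‖ ≤ 2 * (‖Q‖ ^ y)⁻¹ := by
    split_ifs
    · refine (norm_add_le _ _).trans ?_
      rw [zpow_natCast, zpow_neg, zpow_natCast, norm_pow, norm_inv, norm_pow]
      have : ‖Q‖ ^ x ≤ 1 := pow_le_one₀ (norm_nonneg _) hQ.le
      linarith
    · rw [norm_one]; linarith
  rw [bggKernel, norm_mul, norm_mul, norm_mul]
  have h3 : ‖Q ^ ((y : ℤ) * y)‖ = ‖Q‖ ^ (y ^ 2) := by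
    rw [← sq, ← Nat.cast_pow, zpow_natCast, norm_pow]
  beta_reduce
  rw [h3, norm_mul, norm_pow, norm_pow, norm_inv, inv_pow]
  calc ‖Q‖ ^ y ^ 2 * ‖(if i < d then 1 else Q ^ (y : ℤ))‖ *
        ‖(if i < d ∧ w i then Q ^ (x : ℤ) + Q ^ (-(y : ℤ)) else 1)‖ * ‖invPoch Q (x - y)‖
      ≤ ‖Q‖ ^ y ^ 2 * 1 * (2 * (‖Q‖ ^ y)⁻¹) * C := by
        gcongr
        exact hC _
    _ = (‖Q‖ ^ y)⁻¹ * ‖Q‖ ^ y ^ 2 * (2 * C) := by ring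

theorem isBaileyPair_multisum_one {Q : ℂ} (hQ0 : Q ≠ 0) (hQ : ‖Q‖ < 1) {α : ℤ → ℂ} {β : ℕ → ℂ}
    (h : IsBaileyPair Q 1 α β) {C : ℝ} (hβ : ∀ n, ‖β n‖ ≤ C) (w : ℕ → Bool) (r : ℕ) :
    IsBaileyPair Q 1 (fun m => (Q ^ (m * (m + 1))) ^ r * α m)
      (fun n => ∑' s : Fin r → ℕ, pathTerm r (bggKernel Q w 0) β (Fin.cons n s)) := by
  obtain ⟨b, hb, hk⟩ := exists_norm_bggKernel_le hQ0 hQ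
  induction r with
  | zero => simpa [pathTerm] using h
  | succ r ih =>
    have hstep := ih.step (g := bggKernel Q w 0 0) (μ := fun m => Q ^ (m * (m + 1))) ?_
    · intro n
      refine (hstep n).of_eq (fun m => by beta_reduce; rw [pow_succ']; ring) ?_
      beta_reduce
      rw [tsum_pathTerm_cons_succ (hk w 0) hb hβ n (fun y hy => bggKernel_of_lt Q w 0 0 hy),
        bggKernel_zero_succ]
    · intro n m
      rw [← sum_bailey_kernel hQ0 hQ le_rfl]
      refine Finset.sum_congr rfl fun y _ => ?_
      rw [mul_add, zpow_add₀ hQ0]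
      simp [bggKernel]

/-- The outermost step is peeled first, which shifts the step indices; hence the induction for all
`w`. -/
theorem isBaileyPair_multisum {Q : ℂ} (hQ0 : Q ≠ 0) (hQ : ‖Q‖ < 1) {α : ℤ → ℂ} {β : ℕ → ℂ}
    (h : IsBaileyPair Q 0 α β) (hα : ∀ m, α (-1 - m) = -Q ^ (2 * m + 1) * α m)
    {C : ℝ} (hβ : ∀ n, ‖β n‖ ≤ C) (r d : ℕ) (w : ℕ → Bool) :
    IsBaileyPair Q 0
      (fun m => (∏ i ∈ Finset.range d, Q ^ (m * m) * if w i then Q ^ m + Q ^ (-m) else 1) *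
        ((Q ^ (m * (m + 1))) ^ r * α m))
      (fun n => ∑' s : Fin (r + d) → ℕ, pathTerm (r + d) (bggKernel Q w d) β (Fin.cons n s)) := by
  obtain ⟨b, hb, hk⟩ := exists_norm_bggKernel_le hQ0 hQ
  induction d generalizing w with
  | zero =>
    have h1 := isBaileyPair_multisum_one hQ0 hQ ((isBaileyPair_zero_iff_one hQ0 hQ hα).mp h) hβ w r
    -- The multiplier `Q^(m(m+1))` is invariant under `m ↦ -1 - m`, so antisymmetry survives the `c
    -- = 1` steps and the pair returns to `c = 0`.
    simpa using (isBaileyPair_zero_iff_one hQ0 hQ fun m => by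
      rw [hα, show (-1 - m) * (-1 - m + 1) = m * (m + 1) by ring]; ring).mpr h1
  | succ d ih =>
    have hstep := (ih fun i => w (i + 1)).step (g := bggKernel Q w (d + 1) 0)
      (μ := fun m => Q ^ (m * m) * if w 0 then Q ^ m + Q ^ (-m) else 1) ?_
    · intro n
      refine (hstep n).of_eq (fun m => by beta_reduce; rw [Finset.prod_range_succ']; ring) ?_
      have := tsum_pathTerm_cons_succ (k := r + d) (hk w (d + 1)) hb hβ n
        (fun y hy => bggKernel_of_lt Q w (d + 1) 0 hy)
      rw [bggKernel_succ] at this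
      exact this
    · intro n m
      by_cases hw : w 0 = true
      · have := sum_weighted_bailey_kernel hQ0 hQ n m
        rw [add_zero m] at this
        rw [if_pos hw, ← this]
        refine Finset.sum_congr rfl fun y _ => ?_
        simp [bggKernel, hw]
      · have := sum_bailey_kernel hQ0 hQ zero_le_one n m
        rw [add_zero m] at this
        rw [if_neg hw, mul_one, ← this]
        refine Finset.sum_congr rfl fun y _ => ?_
        simp [bggKernel, hw]

/-! ### The theta side -/

/-- The triple product with `z = q^c`, `p = q^(2k+2)`, reflected in `m`. -/
theorem hasSum_theta_quotient {q : ℂ} (hq0 : q ≠ 0) (hq : ‖q‖ < 1) (k : ℕ) (c a b : ℤ)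
    (ha : a = 2 * k + 2 + c) (hb : b = 2 * k + 2 - c) :
    HasSum (fun m : ℤ => (-1) ^ m * q ^ ((2 * k + 2) * m ^ 2 - c * m))
      (qPochInf3 (q ^ (4 * k + 4)) (q ^ a) (q ^ b) (q ^ (4 * k + 4))) := by
  have hp0 : q ^ (2 * k + 2) ≠ 0 := pow_ne_zero _ hq0
  have hp : ‖q ^ (2 * k + 2)‖ < 1 := by
    rw [norm_pow]; exact pow_lt_one₀ (norm_nonneg _) hq (by omega)
  have h := (Equiv.neg ℤ).hasSum_iff.mpr
    (hasSum_jacobi_triple_product (zpow_ne_zero c hq0) hp0 hp)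
  have e1 : (q ^ (2 * k + 2)) ^ 2 = q ^ (4 * k + 4) := by rw [← pow_mul]; congr 1; ring
  have e2 : q ^ c * q ^ (2 * k + 2) = q ^ a := by
    rw [← zpow_natCast q (2 * k + 2), ← zpow_add₀ hq0, ha]; congr 1; push_cast; ring
  have e3 : q ^ (2 * k + 2) / q ^ c = q ^ b := by
    rw [← zpow_natCast q (2 * k + 2), ← zpow_sub₀ hq0, hb]; congr 1
  rw [e1, e2, e3] at h
  refine h.of_eq (fun m => ?_) rfl
  simp only [Function.comp, Equiv.neg_apply, neg_sq]
  rw [neg_eq_neg_one_mul (q ^ c), mul_zpow, zpow_neg (-1 : ℂ), ← inv_zpow, inv_neg, inv_one,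
    ← zpow_natCast q (2 * k + 2), ← zpow_mul, ← zpow_mul, mul_assoc, ← zpow_add₀ hq0]
  congr 2; push_cast; ring

/-- The `s`-th binomial term only changes the linear part of the exponent; the two powers in
`initialAlpha` give the two triple products, with `c = ±1 - 2r + 2j - 4s`. -/
theorem hasSum_theta_side {q : ℂ} (hq0 : q ≠ 0) (hq : ‖q‖ < 1) (r d j : ℕ) :
    HasSum (fun m : ℤ => ((q ^ 2) ^ (m * m)) ^ d * ((q ^ 2) ^ m + (q ^ 2) ^ (-m)) ^ j *
        (((q ^ 2) ^ (m * (m + 1))) ^ r * initialAlpha q m))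
      (∑ s ∈ Finset.range (j + 1), (j.choose s : ℂ) *
      (qPochInf3 (q ^ (4 * (r + d) + 4))
          (q ^ (2 * (r + d : ℕ) + 3 - 2 * r + 2 * j - 4 * s : ℤ))
          (q ^ (2 * (r + d : ℕ) + 1 + 2 * r - 2 * j + 4 * s : ℤ)) (q ^ (4 * (r + d) + 4))
        + q * qPochInf3 (q ^ (4 * (r + d) + 4))
          (q ^ (2 * (r + d : ℕ) + 1 - 2 * r + 2 * j - 4 * s : ℤ))
          (q ^ (2 * (r + d : ℕ) + 3 + 2 * r - 2 * j + 4 * s : ℤ)) (q ^ (4 * (r + d) + 4)))) := by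
  refine (hasSum_sum fun (s : ℕ) _ => ((hasSum_theta_quotient hq0 hq (r + d)
    (1 - 2 * r + 2 * j - 4 * s) _ _ ?_ ?_).add ((hasSum_theta_quotient hq0 hq (r + d)
    (-1 - 2 * r + 2 * j - 4 * s) _ _ ?_ ?_).mul_left q)).mul_left (j.choose s : ℂ)).of_eq
      (fun m => ?_) rfl
  · ring
  · ring
  · ring
  · ring
  · rw [add_pow, Finset.mul_sum, Finset.sum_mul]
    refine Finset.sum_congr rfl fun s hs => ?_
    have hsj : s ≤ j := Nat.lt_succ_iff.mp (Finset.mem_range.mp hs)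
    have e : ((q ^ 2) ^ (m * m)) ^ d * (((q ^ 2) ^ m) ^ s * ((q ^ 2) ^ (-m)) ^ (j - s)) *
        ((q ^ 2) ^ (m * (m + 1))) ^ r =
        q ^ ((2 * (r + d : ℕ)) * m ^ 2 - (-2 * r + 2 * j - 4 * s) * m) := by
      simp only [← zpow_natCast, ← zpow_mul]
      simp only [← zpow_add₀ hq0]
      congr 1
      push_cast [Nat.cast_sub hsj]
      ring
    have e1 : q ^ ((2 * (r + d : ℕ) + 2) * m ^ 2 - (1 - 2 * r + 2 * j - 4 * s) * m) =
        q ^ ((2 * (r + d : ℕ)) * m ^ 2 - (-2 * r + 2 * j - 4 * s) * m) * q ^ (2 * m ^ 2 - m) := by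
      rw [← zpow_add₀ hq0]; congr 1; ring
    have e2 : q * q ^ ((2 * (r + d : ℕ) + 2) * m ^ 2 - (-1 - 2 * r + 2 * j - 4 * s) * m) =
        q ^ ((2 * (r + d : ℕ)) * m ^ 2 - (-2 * r + 2 * j - 4 * s) * m) *
          q ^ (2 * m ^ 2 + m + 1) := by
      rw [← zpow_one_add₀ hq0, ← zpow_add₀ hq0]; congr 1; ring
    rw [mul_left_comm q, e1, e2, ← e, initialAlpha]
    ring

/-! ### The multisum side -/

theorem prod_Icc_one_eq {M : Type*} [CommMonoid M] (f : ℕ → M) (k : ℕ) :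
    ∏ i ∈ Finset.Icc 1 k, f i = ∏ i ∈ Finset.range k, f (i + 1) := by
  induction k with
  | zero => simp
  | succ k ih => rw [Finset.prod_Icc_succ_top (by omega), ih, Finset.prod_range_succ]

/-- The limit of the first kernel as the starting point of the path tends to infinity. -/
noncomputable def bggKernelLim (Q : ℂ) (w : ℕ → Bool) (d y : ℕ) : ℂ :=
  Q ^ ((y : ℤ) * y) * (if 0 < d then 1 else Q ^ (y : ℤ)) *
    (if 0 < d ∧ w 0 then Q ^ (-(y : ℤ)) else 1) * (qPochInf Q Q)⁻¹

/-- Since `Q^n → 0`, the first weight `Q^n + Q^(-s_1)` tends to `Q^(-s_1)`: this is why the factor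
with index `1` has a single term. -/
theorem tendsto_bggKernel {Q : ℂ} (hQ : ‖Q‖ < 1) (w : ℕ → Bool) (d y : ℕ) :
    Tendsto (fun n => bggKernel Q w d 0 n y) atTop (𝓝 (bggKernelLim Q w d y)) := by
  refine Tendsto.mul (Tendsto.const_mul _ ?_) ?_
  · split_ifs
    · have h : Tendsto (fun n : ℕ => Q ^ (n : ℤ)) atTop (𝓝 0) := by
        simpa only [zpow_natCast] using tendsto_pow_atTop_nhds_zero_of_norm_lt_one hQ
      simpa using h.add_const (Q ^ (-(y : ℤ)))
    · exact tendsto_const_nhds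
  · exact (tendsto_invPoch hQ).comp
      (tendsto_atTop_add_const_right _ (-(y : ℤ)) tendsto_natCast_atTop_atTop)

theorem exists_norm_initialBeta_le {q : ℂ} (hq : ‖q‖ < 1) :
    ∃ C : ℝ, ∀ n, ‖initialBeta q n‖ ≤ C := by
  have hQ := norm_sq_lt_one hq
  have h : Tendsto (initialBeta q) atTop (𝓝 ((1 + q) * ((qPochInf (q ^ 2) (q ^ 2))⁻¹ *
      (qPochInf (-q) (q ^ 2))⁻¹))) :=
    (((tendsto_invPoch hQ).comp tendsto_natCast_atTop_atTop).mul
      ((tendsto_qPoch _ hQ).inv₀ (qPochInf_ne_zero hQ (by rwa [norm_neg])))).const_mul _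
  obtain ⟨C, -, hC⟩ := exists_norm_le_of_tendsto h
  exact ⟨C, hC⟩

theorem pathTerm_eq_zero_of_not_antitone {k : ℕ} {Q : ℂ} {w : ℕ → Bool} {d : ℕ} {β : ℕ → ℂ}
    {s : Fin (k + 1) → ℕ} (hs : ¬ Antitone s) :
    pathTerm k (fun i => bggKernel Q w d (i + 1)) β s = 0 := by
  rw [Fin.antitone_iff_succ_le] at hs
  push Not at hs
  obtain ⟨i, hi⟩ := hs
  rw [pathTerm, Finset.prod_eq_zero (Finset.mem_univ i) (bggKernel_of_lt _ _ _ _ hi), zero_mul]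

theorem DecTuple.entry_succ {k : ℕ} (s : DecTuple k) (i : Fin k) : s.entry (i + 1) = s.1 i := by
  rw [DecTuple.entry, dif_pos ⟨by omega, by omega⟩]
  rfl

theorem DecTuple.entry_anti {k : ℕ} (s : DecTuple (k + 1)) {i : ℕ} (hi : i < k) :
    s.entry (i + 1 + 1) ≤ s.entry (i + 1) := by
  have h1 := s.entry_succ ⟨i, by omega⟩
  have h2 := s.entry_succ ⟨i + 1, by omega⟩
  simp only at h1 h2
  rw [h1, h2]
  exact s.2 (by simp [Fin.le_def])

theorem pathTerm_decTuple {k : ℕ} (g : ℕ → ℕ → ℕ → ℂ) (β : ℕ → ℂ) (s : DecTuple (k + 1)) :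
    pathTerm k g β s.1 =
      (∏ i ∈ Finset.range k, g i (s.entry (i + 1)) (s.entry (i + 1 + 1))) *
        β (s.entry (k + 1)) := by
  rw [pathTerm, Finset.prod_range]
  congr 1
  · refine Finset.prod_congr rfl fun i _ => ?_
    rw [← s.entry_succ, ← s.entry_succ]
    rfl
  · rw [← s.entry_succ]
    rfl

theorem one_add_mul_qPochInf {q : ℂ} (hq : ‖q‖ < 1) :
    (1 + q) * qPochInf (-q ^ 3) (q ^ 2) = qPochInf (-q) (q ^ 2) := by
  rw [← qPoch_mul_qPochInf (-q) (norm_sq_lt_one hq) 1]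
  congr 1
  · simp [qPoch]
  · congr 1; ring

/-- The seed contributes `(1 + q) / (-q;q²)_{s_k}`, which together with `(-q³;q²)_∞` makes
`(-q^(1+2s_k);q²)_∞`; the prefactor `(q²;q²)_∞` cancels the limit of the first reciprocal. -/
theorem bggTerm_eq {q : ℂ} (hq : ‖q‖ < 1) {k r d : ℕ} (hk : k + 1 = r + d) {T : Finset ℕ}
    (hT : T ⊆ Finset.Icc 1 d) (s : DecTuple (k + 1)) :
    bggTerm q (k + 1) r T s = qPochInf (q ^ 2) (q ^ 2) * qPochInf (-q ^ 3) (q ^ 2) *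
      (bggKernelLim (q ^ 2) (fun i => decide (i + 1 ∈ T)) d (s.1 0) *
        pathTerm k (fun i => bggKernel (q ^ 2) (fun i => decide (i + 1 ∈ T)) d (i + 1))
          (initialBeta q) s.1) := by
  have hQ := norm_sq_lt_one hq
  have hpow : q ^ (2 * (∑ i ∈ Finset.Icc 1 (k + 1), s.entry i ^ 2 +
      ∑ i ∈ Finset.Icc (k + 1 - r + 1) (k + 1), s.entry i)) =
      (∏ i ∈ Finset.range (k + 1), (q ^ 2) ^ ((s.entry (i + 1) : ℤ) * s.entry (i + 1))) *
      ∏ i ∈ Finset.range (k + 1), if i < d then 1 else (q ^ 2) ^ (s.entry (i + 1) : ℤ) := by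
    rw [pow_mul, pow_add, ← Finset.prod_pow_eq_pow_sum, ← Finset.prod_pow_eq_pow_sum,
      prod_Icc_one_eq]
    congr 1
    · refine Finset.prod_congr rfl fun i _ => ?_
      rw [← sq, ← Nat.cast_pow, zpow_natCast]
    · have e : Finset.Icc (k + 1 - r + 1) (k + 1) =
          (Finset.Icc 1 (k + 1)).filter fun i => ¬ i ≤ d := by
        ext i; simp only [Finset.mem_Icc, Finset.mem_filter]; omega
      rw [e, Finset.prod_filter, prod_Icc_one_eq]
      refine Finset.prod_congr rfl fun i _ => ?_
      rw [zpow_natCast, ite_not]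
      simp only [Nat.succ_le_iff]
  have hfac : ∏ i ∈ T, bggFactor q s i =
      ∏ i ∈ Finset.range (k + 1), if i + 1 ∈ T then bggFactor q s (i + 1) else 1 := by
    have hT' : T ⊆ Finset.Icc 1 (k + 1) :=
      hT.trans (Finset.Icc_subset_Icc_right (by omega))
    rw [← prod_Icc_one_eq (fun i => if i ∈ T then bggFactor q s i else 1), Finset.prod_ite_mem,
      Finset.inter_eq_right.mpr hT']
  have hlt : ∀ i, i + 1 ∈ T → i < d := fun i hi => by
    have := (Finset.mem_Icc.mp (hT hi)).2; omega
  have hfac0 : (if 0 + 1 ∈ T then bggFactor q s (0 + 1) else 1) =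
      if 0 < d ∧ decide (0 + 1 ∈ T) = true then (q ^ 2) ^ (-(s.entry 1 : ℤ)) else 1 := by
    by_cases h : 0 + 1 ∈ T
    · rw [if_pos h, if_pos ⟨hlt 0 h, by simpa using h⟩, bggFactor, if_pos rfl, ← zpow_natCast q 2,
        ← zpow_mul]
      congr 1; push_cast; ring
    · rw [if_neg h, if_neg (by simp [h])]
  have hfacs : ∀ i, (if i + 1 + 1 ∈ T then bggFactor q s (i + 1 + 1) else 1) =
      if i + 1 < d ∧ decide (i + 1 + 1 ∈ T) = true then
        (q ^ 2) ^ (s.entry (i + 1) : ℤ) + (q ^ 2) ^ (-(s.entry (i + 1 + 1) : ℤ)) else 1 := by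
    intro i
    by_cases h : i + 1 + 1 ∈ T
    · rw [if_pos h, if_pos ⟨hlt _ h, by simpa using h⟩, bggFactor, if_neg (by omega),
        ← zpow_natCast q 2, ← zpow_mul, ← zpow_mul, Nat.add_sub_cancel]
      congr 2; push_cast; ring
    · rw [if_neg h, if_neg (by simp [h])]
  have hden : (∏ i ∈ Finset.Icc 1 (k + 1 - 1),
      qPoch (q ^ 2) (q ^ 2) (s.entry i - s.entry (i + 1)))⁻¹ =
      ∏ i ∈ Finset.range k, invPoch (q ^ 2) (s.entry (i + 1) - s.entry (i + 1 + 1)) := by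
    rw [Nat.add_sub_cancel, prod_Icc_one_eq, ← Finset.prod_inv_distrib]
    refine Finset.prod_congr rfl fun i hi => ?_
    rw [← Nat.cast_sub (s.entry_anti (Finset.mem_range.mp hi)), invPoch_natCast]
  have hlast : qPochInf (-q ^ (1 + 2 * s.entry (k + 1))) (q ^ 2) =
      (1 + q) * qPochInf (-q ^ 3) (q ^ 2) *
        (qPoch (-q) (q ^ 2) (s.entry (k + 1)))⁻¹ := by
    have hne := qPoch_ne_zero hQ (a := -q) (by rwa [norm_neg]) (s.entry (k + 1))
    rw [one_add_mul_qPochInf hq, ← qPoch_mul_qPochInf (-q) hQ (s.entry (k + 1)),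
      show -q * (q ^ 2) ^ s.entry (k + 1) = -q ^ (1 + 2 * s.entry (k + 1)) by
        rw [pow_add, pow_mul]; ring]
    field_simp
  have hzero : s.1 0 = s.entry 1 := (s.entry_succ 0).symm
  have hinf := qPochInf_ne_zero hQ hQ
  have hcancel : ∀ I A K P : ℂ, I ≠ 0 → I * A * (K * I⁻¹ * P) = A * K * P := by
    intros; field_simp
  rw [bggKernelLim, hcancel _ _ _ _ hinf, bggTerm, div_eq_mul_inv, mul_inv, hden, hpow, hfac,
    hlast, pathTerm_decTuple, hzero, initialBeta, Finset.prod_range_succ', Finset.prod_range_succ',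
    Finset.prod_range_succ', hfac0, ← invPoch_natCast]
  simp only [hfacs, bggKernel, Finset.prod_mul_distrib, zero_add]
  ring

theorem prod_range_weights {T : Finset ℕ} {d : ℕ} (hT : T ⊆ Finset.Icc 1 d) (x y : ℂ) :
    (∏ i ∈ Finset.range d, x * if decide (i + 1 ∈ T) = true then y else 1) =
      x ^ d * y ^ T.card := by
  simp only [decide_eq_true_eq]
  rw [Finset.prod_mul_distrib, Finset.prod_const, Finset.card_range,
    ← prod_Icc_one_eq (fun i => if i ∈ T then y else 1), Finset.prod_ite_mem,
    Finset.inter_eq_right.mpr hT, Finset.prod_const]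

/-- Both sides of the iterated pair are compared as `n → ∞`. The `α` side carries `1/(Q;Q)_∞²`, and
clearing the `1/(Q;Q)_∞` of the `β` side leaves the single one in the prefactor. -/
theorem hasSum_bggTerm {q : ℂ} (hq0 : q ≠ 0) (hq : ‖q‖ < 1) {k r d : ℕ} (hk1 : 1 ≤ k)
    (hk : k = r + d) {T : Finset ℕ} (hT : T ⊆ Finset.Icc 1 d) :
    HasSum (bggTerm q k r T) (bggProductSide q k r T.card) := by
  have hQ := norm_sq_lt_one hq
  have hQ0 : q ^ 2 ≠ 0 := pow_ne_zero 2 hq0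
  obtain ⟨C, hC⟩ := exists_norm_initialBeta_le hq
  obtain ⟨b, hb, hbk⟩ := exists_norm_bggKernel_le hQ0 hQ
  have hpair := isBaileyPair_multisum hQ0 hQ (isBaileyPair_initial hq0 hq)
    (initialAlpha_antisymm hq0) hC r d (fun i => decide (i + 1 ∈ T))
  have hθ := hasSum_theta_side hq0 hq r d T.card
  simp only [← prod_range_weights hT] at hθ
  rw [← hk] at hpair hθ
  obtain ⟨k, rfl⟩ : ∃ l, k = l + 1 := ⟨k - 1, by omega⟩
  obtain ⟨hL, hlim⟩ := tendsto_tsum_pathTerm_cons (k := k)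
    (hbk (fun i => decide (i + 1 ∈ T)) d) hb hC (tendsto_bggKernel hQ _ d)
  have hlim' := tendsto_tsum_mul_invPoch hQ hθ.summable
  rw [hθ.tsum_eq] at hlim'
  have hval := tendsto_nhds_unique hlim (hlim'.congr fun n => by
    refine Eq.trans ?_ (hpair n).tsum_eq
    simp only [add_zero])
  have hsum := hL.hasSum.mul_left (qPochInf (q ^ 2) (q ^ 2) * qPochInf (-q ^ 3) (q ^ 2))
  -- Tuples that are not decreasing contribute zero, so the sum over all tuples restricts to
  -- `DecTuple`.
  rw [← Subtype.val_injective (p := fun s : Fin (k + 1) → ℕ => Antitone s).hasSum_iff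
    fun s hs => ?_] at hsum
  · refine hsum.of_eq (fun s => bggTerm_eq hq hk hT s) ?_
    rw [hval, bggProductSide]
    have hinf := qPochInf_ne_zero hQ hQ
    field_simp
  · rw [pathTerm_eq_zero_of_not_antitone (fun h => hs ⟨⟨s, h⟩, rfl⟩), mul_zero, mul_zero]

theorem mainTheorem4 (q : ℂ) (hq0 : q ≠ 0) (hq1 : ‖q‖ < 1)
    (j r k : ℕ) (hk : 1 ≤ k) (hjr : j + r ≤ k) :
    HasSum (bggTerm q k r (Finset.Icc 1 j)) (bggProductSide q k r j) ∧
    ∀ T : Finset ℕ, T ⊆ {1} ∪ Finset.Icc 2 (k - r) → T.card = j →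
      HasSum (bggTerm q k r T) (bggProductSide q k r j) := by
  have hkr : k = r + (k - r) := by omega
  constructor
  · have h := hasSum_bggTerm hq0 hq1 hk hkr (T := Finset.Icc 1 j)
      (Finset.Icc_subset_Icc_right (by omega))
    simpa using h
  · rintro T hT rfl
    refine hasSum_bggTerm hq0 hq1 hk hkr fun i hi => ?_
    -- For `k = r` the allowed set still contains the index `1`, although there is no outer step; a
    -- nonempty `T` has `j ≥ 1`, and `j + r ≤ k` then gives `1 ≤ k - r`.
    have hpos : 0 < T.card := Finset.card_pos.mpr ⟨i, hi⟩
    have := hT hi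
    simp only [Finset.mem_union, Finset.mem_singleton, Finset.mem_Icc] at this ⊢
    omega
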